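/- **Splitting Lemma.** Let $V$ be a complete discrete valuation ring with uniformizer $\pi$ and residue field $\kappa$. Assume that $\kappa$ is quadratically closed (every element of $\kappa$ is a square) and that $\operatorname{char}\kappa \neq 2$. Let $n \geq 0$, and let $f \in V[[x_1,\dots,x_n]]$ have order $2$, i.e. $f \in \mathfrak{m}_V^2\setminus\mathfrak{m}_V^3$, where $\mathfrak{m}_V=\langle \pi,x_1,\dots,x_n\rangle$. Write $f=\sum_\alpha u_\alpha\pi^{n_\alpha}x^\alpha$, where for every $\alpha$ either $u_\alpha$ is a unit of $V$ and $n_\alpha\ge 0$, or $u_\alpha = 0$ (when the coefficient of $x^\alpha$ vanishes), and set $$\tilde f=\sum_\alpha u_\alpha y^{n_\alpha}x^\alpha\in V[[x_1,\dots,x_n,y]].$$ Then there are an integer $0\le k\le n$, a power series $g(x_{k+1},\dots,x_n)$ in the ideal $$\mathfrak{a}_3=\langle x_{k+1},\dots,x_n\rangle^3+\langle\pi\rangle\langle x_{k+1},\dots,x_n\rangle^2+\langle\pi^2\rangle\langle x_{k+1},\dots,x_n\rangle$$ of $V[[x_{k+1},\dots,x_n]]$, and a $V$-algebra automorphism $\varphi$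 of $V[[x_1,\dots,x_n,y]]$ such that $$\varphi(\tilde f)=y^2+x_1^2+\cdots+x_k^2+g(x_{k+1},\dots,x_n).$$ -/

import Mathlib

open MvPowerSeries

noncomputable section

namespace DVRSeries

/-- A field is quadratically closed if each of its elements is a square. -/
def QuadraticallyClosed (K : Type*) [Field K] : Prop :=
  ∀ a : K, IsSquare a

/-- `HasOrder I f k` says that `ord_I f = k`: `k` is the largest natural number with `f ∈ I ^ k`. -/
def HasOrder {R : Type*} [CommRing R] (I : Ideal R) (f : R) (k : ℕ) : Prop :=
  IsGreatest {j : ℕ | f ∈ I ^ j} k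

/-- For a uniformizer `ϖ` and `a = u * ϖ ^ m` with `u` a unit, `unitPart ϖ a = u`
(while `m = multiplicity ϖ a`); the unit part of `0` is taken to be `0`. -/
def unitPart {V : Type*} [CommRing V] (ϖ a : V) : V :=
  open Classical in if a = 0 then 0 else (pow_multiplicity_dvd ϖ a).choose

/-- The series `f̃ = ∑ u_α y ^ n_α x ^ α` attached to `f = ∑ u_α ϖ ^ n_α x ^ α`, where the `u_α` are
units (or `0`, where the coefficient vanishes). The variables of the target are indexed by
`Option (Fin n)`: `none` is the new variable `y`, and `some i` is the `i`-th variable `x`.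
So the coefficient at `y ^ m x ^ α` is `u_α` if `m = n_α`, and `0` otherwise. -/
def tilde {V : Type*} [CommRing V] {n : ℕ} (ϖ : V) (f : MvPowerSeries (Fin n) V) :
    MvPowerSeries (Option (Fin n)) V :=
  fun β => if β none = multiplicity ϖ (coeff β.some f) then unitPart ϖ (coeff β.some f) else 0

/-- Right equivalence: some `R`-algebra automorphism of the power series ring takes `f` to `g`. -/
def RightEquiv {R σ : Type*} [CommRing R] (f g : MvPowerSeries σ R) : Prop :=
  ∃ φ : MvPowerSeries σ R ≃ₐ[R] MvPowerSeries σ R, φ f = g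

/-- The ideal `𝔞_r = ∑_{i < r} ⟨ϖ ^ i⟩ * ⟨variables⟩ ^ (r - i)` of the power series ring over `V`
in the variables indexed by `σ`. -/
def idealA {V : Type*} [CommRing V] (ϖ : V) (σ : Type*) (r : ℕ) : Ideal (MvPowerSeries σ V) :=
  ∑ i ∈ Finset.range r,
    Ideal.span {(C (ϖ ^ i) : MvPowerSeries σ V)} *
      Ideal.span (Set.range (X : σ → MvPowerSeries σ V)) ^ (r - i)

/-- Indices of the variables `x_{k+1}, …, x_n`; the element `i` of `Fin n` stands for `x_{i+1}`. -/
abbrev TailIndex (n k : ℕ) : Type := {i : Fin n // k ≤ (i : ℕ)}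

/-- The inclusion of `V[[x_{k+1}, …, x_n]]` into `V[[x_1, …, x_n, y]]`. -/
def tailIncl (V : Type*) [CommRing V] (n k : ℕ) :
    MvPowerSeries (TailIndex n k) V →ₐ[V] MvPowerSeries (Option (Fin n)) V :=
  rename (fun i : TailIndex n k => some i.1)

end DVRSeries

end

noncomputable section

namespace DVRSeries

/-! ### The weight filtration and fixed points of contractions -/

section Filtration

variable {σ R : Type*} [CommRing R]

/-! Replacing the uniformizer by `y` turns weight in `f` into ordinary degree in the variables.
Since `f` has order two, its transform `F` has no terms of degree below two (`tilde_mem_filt`), and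
its quadratic part is nonzero over the residue field, as otherwise `f` would have order at least
three (`mem_filt_of_tilde_mem_filt`).

Two filtrations are tracked together: `filt ⊥`, the degree in the variables alone, and `filt` of the
maximal ideal, where the scalars in it also have weight one. The residue quadratic form is a sum of
`r ≥ 1` squares in suitable coordinates (`exists_diagonalization`). Lifting that change of
coordinates brings `F` to a sum of squares plus an error of weight three and degree at least two.

The error is absorbed by completing all squares at once (`exists_splitting`): a substitution `X i +
a i` solves the problem when `a` is a fixed point of a contraction, which exists by completeness,
and it is invertible because `a` has weight two. Any `r` variables may carry the squares, so `y` is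
taken among them and `k = r - 1`. The remainder has weight three and degree at least two, which puts
it in the required ideal (`mem_idealA_three`). -/

lemma smul_pow_mem_of_degree (I : Ideal R) {a b : R} {j k l : ℕ} (ha : a ∈ I ^ j) (hb : b ∈ I ^ k)
    (h : l ≤ j + k) : a * b ∈ I ^ l :=
  Ideal.pow_le_pow_right h (pow_add I j k ▸ Ideal.mul_mem_mul ha hb)

/-- The filtration of the power series ring in which the elements of `I` and the variables have
weight one. -/
def filt (I : Ideal R) (k : ℕ) : Ideal (MvPowerSeries σ R) where
  carrier := {f | ∀ d, coeff d f ∈ I ^ (k - d.degree)}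
  add_mem' hf hg d := by rw [map_add]; exact add_mem (hf d) (hg d)
  zero_mem' d := by simp
  smul_mem' c f hf d := by
    classical
    rw [smul_eq_mul, coeff_mul]
    refine sum_mem fun p hp => Ideal.mul_mem_left _ _ (Ideal.pow_le_pow_right ?_ (hf p.2))
    have := congrArg Finsupp.degree (Finset.HasAntidiagonal.mem_antidiagonal.mp hp)
    rw [map_add] at this
    omega

variable {I : Ideal R} {j k l : ℕ} {f g : MvPowerSeries σ R}

/-- Since `⊥ ^ 0 = ⊤` while positive powers of `⊥` vanish, the ideal `⊥` recovers the filtration by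
degree in the variables. -/
lemma mem_filt_bot : f ∈ filt (⊥ : Ideal R) k ↔ ∀ d : σ →₀ ℕ, d.degree < k → coeff d f = 0 := by
  refine forall_congr' fun d => ?_
  by_cases h : d.degree < k
  · rw [Ideal.bot_pow (by omega)]
    simp [h]
  · simp [h, Nat.sub_eq_zero_of_le (not_lt.mp h)]

lemma filt_anti (h : j ≤ k) : filt (σ := σ) I k ≤ filt I j :=
  fun _ hf d => Ideal.pow_le_pow_right (by omega) (hf d)

lemma filt_mono {J : Ideal R} (h : I ≤ J) : filt (σ := σ) I k ≤ filt J k :=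
  fun _ hf d => Ideal.pow_right_mono h _ (hf d)

lemma filt_zero : filt (σ := σ) I 0 = ⊤ := by
  rw [eq_top_iff]
  intro f _ d
  simp

lemma mul_mem_filt (hf : f ∈ filt I j) (hg : g ∈ filt I k) : f * g ∈ filt I (j + k) := by
  classical
  intro d
  rw [coeff_mul]
  refine sum_mem fun p hp => smul_pow_mem_of_degree I (hf p.1) (hg p.2) ?_
  have := congrArg Finsupp.degree (Finset.HasAntidiagonal.mem_antidiagonal.mp hp)
  rw [map_add] at this
  omega

lemma pow_filt_le : filt (σ := σ) I 1 ^ k ≤ filt I k := by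
  induction k with
  | zero => simp [filt_zero]
  | succ k ih =>
    rw [pow_succ]
    exact Ideal.mul_le.mpr fun f hf g hg => mul_mem_filt (ih hf) hg

lemma X_mem_filt (i : σ) : (X i : MvPowerSeries σ R) ∈ filt I 1 := by
  refine filt_mono bot_le (mem_filt_bot.mpr fun d hd => ?_)
  obtain rfl : d = 0 := (Finsupp.degree_eq_zero_iff d).mp (by omega)
  exact coeff_zero_X i

lemma C_mem_filt {c : R} (hc : c ∈ I ^ k) : (C c : MvPowerSeries σ R) ∈ filt I k := by
  classical
  intro d
  rw [coeff_C]
  split_ifs with h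
  · exact Ideal.pow_le_pow_right (by omega) hc
  · exact zero_mem _

lemma mem_filt_one_of_constantCoeff (h : constantCoeff f ∈ I) : f ∈ filt I 1 := by
  intro d
  by_cases hd : d = 0
  · subst hd
    simpa using h
  · have : d.degree ≠ 0 := fun h0 => hd ((Finsupp.degree_eq_zero_iff d).mp h0)
    simp [show 1 - d.degree = 0 by omega]

lemma eq_zero_of_forall_mem_filt [IsHausdorff I R] (h : ∀ k, f ∈ filt I k) : f = 0 := by
  ext d
  refine IsHausdorff.haus' (I := I) _ fun n => ?_
  rw [SModEq.zero, smul_eq_mul, Ideal.mul_top]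
  simpa using h (n + d.degree) d

lemma exists_limit [IsPrecomplete I R] (u : ℕ → MvPowerSeries σ R)
    (hu : ∀ k, u (k + 1) - u k ∈ filt I k) : ∃ a, ∀ k, a - u k ∈ filt I k := by
  have hmono : ∀ j l, u (j + l) - u j ∈ filt I j := by
    intro j l
    induction l with
    | zero => simp
    | succ l ih =>
      rw [← sub_add_sub_cancel _ (u (j + l))]
      exact add_mem (filt_anti (by omega) (hu (j + l))) ih
  have key : ∀ d : σ →₀ ℕ, ∃ L : R, ∀ n, coeff d (u (n + d.degree)) - L ∈ I ^ n := by
    intro d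
    -- At `d` the filtration controls only `I ^ (k - d.degree)`, so the sequence is shifted by
    -- `d.degree`.
    obtain ⟨L, hL⟩ := IsPrecomplete.prec' (I := I) (fun n => coeff d (u (n + d.degree))) (by
      intro m n hmn
      rw [SModEq.sub_mem, smul_eq_mul, Ideal.mul_top, ← neg_sub, neg_mem_iff, ← map_sub]
      obtain ⟨l, rfl⟩ := Nat.exists_eq_add_of_le hmn
      have := hmono (m + d.degree) l d
      rwa [Nat.add_sub_cancel, add_right_comm] at this)
    refine ⟨L, fun n => ?_⟩
    have := hL n
    rwa [SModEq.sub_mem, smul_eq_mul, Ideal.mul_top] at this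
  choose L hL using key
  let a : MvPowerSeries σ R := L
  refine ⟨a, fun k d => ?_⟩
  rcases le_total k d.degree with h | h
  · simp [Nat.sub_eq_zero_of_le h]
  · have := hL d (k - d.degree)
    rw [Nat.sub_add_cancel h] at this
    rw [map_sub, ← neg_sub, neg_mem_iff]
    exact this

/-- A contraction of an invariant subset that is closed in the topology of the filtration has a
fixed point. -/
theorem exists_fixedPoint [IsAdicComplete I R] {ι : Type*}
    (T : (ι → MvPowerSeries σ R) → ι → MvPowerSeries σ R) (p : (ι → MvPowerSeries σ R) → Prop)
    (h0 : p 0) (hT : ∀ a, p a → p (T a))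
    (hclosed : ∀ a, (∀ k, ∃ b, p b ∧ ∀ i, a i - b i ∈ filt I k) → p a)
    (hcontr : ∀ k a b, p a → p b → (∀ i, a i - b i ∈ filt I k) →
      ∀ i, T a i - T b i ∈ filt I (k + 1)) :
    ∃ a, p a ∧ T a = a := by
  let u : ℕ → ι → MvPowerSeries σ R := fun k => T^[k] 0
  have hsucc : ∀ k, u (k + 1) = T (u k) := fun k => Function.iterate_succ_apply' T k 0
  have hp : ∀ k, p (u k) := by
    intro k
    induction k with
    | zero => exact h0
    | succ k ih => rw [hsucc]; exact hT _ ih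
  have hu : ∀ k i, u (k + 1) i - u k i ∈ filt I k := by
    intro k
    induction k with
    | zero => intro i; simp [filt_zero]
    | succ k ih =>
      intro i
      rw [hsucc (k + 1), hsucc k]
      exact hcontr k _ _ (hsucc k ▸ hp (k + 1)) (hp k) (hsucc k ▸ ih) i
  choose a ha using fun i => exists_limit (I := I) (fun k => u k i) fun k => hu k i
  have hpa : p a := hclosed a fun k => ⟨u k, hp k, fun i => ha i k⟩
  refine ⟨a, hpa, funext fun i => ?_⟩
  rw [← sub_eq_zero]
  refine eq_zero_of_forall_mem_filt (I := I) fun k => ?_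
  have h1 := hcontr k a (u k) hpa (hp k) (fun i => ha i k) i
  rw [← hsucc] at h1
  rw [← sub_sub_sub_cancel_right _ _ (u (k + 1) i)]
  exact filt_anti (Nat.le_succ k) (sub_mem h1 (ha i (k + 1)))

end Filtration

/-! ### Substitutions and their effect on weights -/

section Substitution

variable {σ τ R : Type*} [CommRing R] {I : Ideal R} {k : ℕ}

lemma finsuppProd_mem_filt {a : σ → MvPowerSeries τ R} (ha : ∀ i, a i ∈ filt I 1) (d : σ →₀ ℕ) :
    (d.prod fun i e => a i ^ e) ∈ filt I d.degree := by
  classical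
  induction d using Finsupp.induction_linear with
  | zero => simp [filt_zero]
  | add d e hd he =>
    rw [Finsupp.prod_add_index' (by simp) (fun _ _ _ => pow_add _ _ _), map_add]
    exact mul_mem_filt hd he
  | single i m =>
    rw [Finsupp.prod_single_index (by simp), Finsupp.degree_single]
    exact pow_filt_le (Ideal.pow_mem_pow (ha i) m)

lemma finsuppProd_sub_mem_filt {a b : σ → MvPowerSeries τ R} (ha : ∀ i, a i ∈ filt I 1)
    (hb : ∀ i, b i ∈ filt I 1) (hab : ∀ i, a i - b i ∈ filt I 2) (d : σ →₀ ℕ) :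
    (d.prod fun i e => a i ^ e) - (d.prod fun i e => b i ^ e) ∈ filt I (d.degree + 1) := by
  classical
  have mul : ∀ {j k} {p q r s : MvPowerSeries τ R}, p - q ∈ filt I (j + 1) →
      r - s ∈ filt I (k + 1) → q ∈ filt I j → r ∈ filt I k →
      p * r - q * s ∈ filt I (j + k + 1) := by
    intro j k p q r s hpq hrs hq hr
    rw [show p * r - q * s = (p - q) * r + q * (r - s) by ring]
    exact add_mem (filt_anti (by omega) (mul_mem_filt hpq hr))
      (filt_anti (by omega) (mul_mem_filt hq hrs))
  induction d using Finsupp.induction_linear with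
  | zero => simp
  | add d e hd he =>
    simp only [Finsupp.prod_add_index' (h_zero := fun i => pow_zero (a i))
      (h_add := fun i _ _ => pow_add (a i) _ _), Finsupp.prod_add_index'
      (h_zero := fun i => pow_zero (b i)) (h_add := fun i _ _ => pow_add (b i) _ _), map_add]
    exact mul hd he (finsuppProd_mem_filt hb d) (finsuppProd_mem_filt ha e)
  | single i m =>
    rw [Finsupp.prod_single_index (by simp), Finsupp.prod_single_index (by simp),
      Finsupp.degree_single]
    induction m with
    | zero => simp
    | succ m ih =>
      rw [pow_succ, pow_succ]
      exact mul ih (hab i) (pow_filt_le (Ideal.pow_mem_pow (hb i) m)) (ha i)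

lemma finsum_mem_ideal {ι : Type*} (J : Ideal R) {u : ι → R} (h : ∀ i, u i ∈ J) :
    ∑ᶠ i, u i ∈ J :=
  finsum_induction (· ∈ J) J.zero_mem (fun _ _ => J.add_mem) h

lemma subst_mem_filt {a : σ → MvPowerSeries τ R} (ha : HasSubst a) (ha1 : ∀ i, a i ∈ filt I 1)
    {f : MvPowerSeries σ R} (hf : f ∈ filt I k) : subst a f ∈ filt I k := by
  intro e
  rw [coeff_subst ha]
  exact finsum_mem_ideal _ fun d =>
    smul_pow_mem_of_degree I (hf d) (finsuppProd_mem_filt ha1 d e) (by omega)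

lemma subst_sub_subst_mem_filt {a b : σ → MvPowerSeries τ R} (ha : HasSubst a) (hb : HasSubst b)
    (ha1 : ∀ i, a i ∈ filt I 1) (hb1 : ∀ i, b i ∈ filt I 1) (hab : ∀ i, a i - b i ∈ filt I 2)
    {f : MvPowerSeries σ R} (hf : f ∈ filt I k) : subst a f - subst b f ∈ filt I (k + 1) := by
  intro e
  rw [map_sub, coeff_subst ha, coeff_subst hb,
    ← finsum_sub_distrib (coeff_subst_finite ha f e) (coeff_subst_finite hb f e)]
  refine finsum_mem_ideal _ fun d => ?_
  rw [← smul_sub, ← map_sub]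
  exact smul_pow_mem_of_degree I (hf d) (finsuppProd_sub_mem_filt ha1 hb1 hab d e) (by omega)

/-- Only the variables that occur in `f` matter; this shows that the final substitution fixes the
remainder. -/
lemma subst_congr {a b : σ → MvPowerSeries τ R} (ha : HasSubst a) (hb : HasSubst b)
    {f : MvPowerSeries σ R} (h : ∀ d, coeff d f ≠ 0 → ∀ i ∈ d.support, a i = b i) :
    subst a f = subst b f := by
  ext e
  rw [coeff_subst ha, coeff_subst hb]
  refine finsum_congr fun d => ?_
  by_cases hd : coeff d f = 0
  · simp [hd]
  · rw [Finsupp.prod_congr fun i hi => by rw [h d hd i hi]]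

/-- A substitution that differs from the identity by terms of weight at least two is bijective. -/
theorem bijective_subst_X_add [IsAdicComplete I R] {a : σ → MvPowerSeries σ R}
    (ha : HasSubst fun i => X i + a i) (ha2 : ∀ i, a i ∈ filt I 2) :
    Function.Bijective (substAlgHom (R := R) ha) := by
  -- The substitution minus the identity raises weight by one. Hence a kernel element has
  -- arbitrarily high weight, and preimages are found by iteration.
  have hN : ∀ k (f : MvPowerSeries σ R), f ∈ filt I k →
      substAlgHom (R := R) ha f - f ∈ filt I (k + 1) := by
    intro k f hf
    have := subst_sub_subst_mem_filt (I := I) ha HasSubst.X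
      (fun i => add_mem (X_mem_filt i) (filt_anti one_le_two (ha2 i))) X_mem_filt
      (fun i => by simpa using ha2 i) hf
    rwa [subst_self, id, ← substAlgHom_apply ha] at this
  constructor
  · rw [injective_iff_map_eq_zero]
    intro f hf
    refine eq_zero_of_forall_mem_filt (I := I) fun k => ?_
    induction k with
    | zero => simp [filt_zero]
    | succ k ih => simpa [hf] using hN k f ih
  · intro g
    obtain ⟨f, -, hf⟩ := exists_fixedPoint (I := I) (ι := Unit)
      (fun f i => g - (substAlgHom (R := R) ha (f i) - f i)) (fun _ => True) trivial
      (fun _ _ => trivial) (fun _ _ => trivial) (by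
        intro k f f' _ _ h i
        have := neg_mem (hN k _ (h i))
        rw [map_sub] at this
        convert this using 1
        ring)
    have := congrFun hf ()
    refine ⟨f (), ?_⟩
    linear_combination -this

end Substitution

/-! ### Completing the squares -/

section Splitting

variable {σ R : Type*} [CommRing R]

open Classical in
/-- A variable of `S` that divides the monomial with exponent `d`, if there is one. -/
def lead (S : Finset σ) (d : σ →₀ ℕ) : Option σ :=
  if h : ∃ i ∈ S, d i ≠ 0 then some h.choose else none

lemma lead_eq_some {S : Finset σ} {d : σ →₀ ℕ} {i : σ} (h : lead S d = some i) :
    i ∈ S ∧ d i ≠ 0 := by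
  unfold lead at h
  split_ifs at h with h'
  obtain rfl := Option.some.inj h
  exact h'.choose_spec

lemma lead_eq_none {S : Finset σ} {d : σ →₀ ℕ} : lead S d = none ↔ ∀ i ∈ S, d i = 0 := by
  unfold lead
  split_ifs with h
  · simpa using h
  · simpa using h

open Classical in
/-- The quotient of the part of `f` whose monomials are divided by their leading variable `X i`. -/
def divX (S : Finset σ) (i : σ) (f : MvPowerSeries σ R) : MvPowerSeries σ R :=
  fun d => if lead S (d + Finsupp.single i 1) = some i then coeff (d + Finsupp.single i 1) f else 0

/-- The part of `f` that does not involve the variables in `S`. -/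
def rest (S : Finset σ) (f : MvPowerSeries σ R) : MvPowerSeries σ R :=
  fun d => if lead S d = none then coeff d f else 0

open Classical in
lemma coeff_divX (S : Finset σ) (i : σ) (f : MvPowerSeries σ R) (d : σ →₀ ℕ) :
    coeff d (divX S i f) =
      if lead S (d + Finsupp.single i 1) = some i then coeff (d + Finsupp.single i 1) f else 0 :=
  rfl

lemma coeff_rest (S : Finset σ) (f : MvPowerSeries σ R) (d : σ →₀ ℕ) :
    coeff d (rest S f) = if lead S d = none then coeff d f else 0 := rfl

/-- The leading variable depends on the exponent alone, not on the series. The resulting additivity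
is what makes the iteration below a contraction. -/
lemma divX_sub (S : Finset σ) (i : σ) (f g : MvPowerSeries σ R) :
    divX S i (f - g) = divX S i f - divX S i g := by
  ext d
  rw [map_sub]
  simp only [coeff_divX, map_sub]
  split_ifs <;> simp

lemma divX_mem_filt {I : Ideal R} {k : ℕ} {S : Finset σ} {i : σ} {f : MvPowerSeries σ R}
    (hf : f ∈ filt I (k + 1)) : divX S i f ∈ filt I k := by
  intro d
  rw [coeff_divX]
  split_ifs
  · have := hf (d + Finsupp.single i 1)
    rwa [map_add, Finsupp.degree_single, Nat.add_sub_add_right] at this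
  · exact zero_mem _

lemma rest_mem_filt {I : Ideal R} {k : ℕ} {S : Finset σ} {f : MvPowerSeries σ R}
    (hf : f ∈ filt I k) : rest S f ∈ filt I k := by
  intro d
  rw [coeff_rest]
  split_ifs
  · exact hf d
  · exact zero_mem _

open Classical in
lemma coeff_X_mul_divX (S : Finset σ) (i : σ) (f : MvPowerSeries σ R) (d : σ →₀ ℕ) :
    coeff d (X i * divX S i f) = if lead S d = some i then coeff d f else 0 := by
  rw [X_def, coeff_monomial_mul, one_mul]
  by_cases h : d i = 0
  · have h1 : ¬ Finsupp.single i 1 ≤ d := by simp [h]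
    have h2 : ¬ lead S d = some i := fun h2 => (lead_eq_some h2).2 h
    rw [if_neg h1, if_neg h2]
  · have h1 : Finsupp.single i 1 ≤ d := by simp; omega
    rw [if_pos h1, coeff_divX, tsub_add_cancel_of_le h1]

lemma sum_X_mul_divX_add_rest (S : Finset σ) (f : MvPowerSeries σ R) :
    ∑ i ∈ S, X i * divX S i f + rest S f = f := by
  classical
  ext d
  simp only [map_add, map_sum, coeff_X_mul_divX, coeff_rest]
  rcases h : lead S d with _ | i
  · simp
  · simp [(lead_eq_some h).1]

variable [Finite σ] {I : Ideal R}

/-- Splitting off of squares: if `F` has weight three and order two, then `∑ i ∈ S, X i ^ 2 + F` is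
right equivalent to `∑ i ∈ S, X i ^ 2 + g` for some `g` without the variables in `S`. -/
theorem exists_splitting [IsAdicComplete I R] (h2 : IsUnit (2 : R)) (S : Finset σ)
    {F : MvPowerSeries σ R} (hF : F ∈ filt I 3) (hF2 : F ∈ filt ⊥ 2) :
    ∃ g : MvPowerSeries σ R, g ∈ filt I 3 ∧ g ∈ filt ⊥ 2 ∧
      (∀ d, coeff d g ≠ 0 → ∀ i ∈ S, d i = 0) ∧
      RightEquiv (∑ i ∈ S, X i ^ 2 + F) (∑ i ∈ S, X i ^ 2 + g) := by
  obtain ⟨c, hc⟩ := h2.exists_right_inv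
  -- Expanding the squares of `X i + a i`, the requirement becomes `∑ 2 * X i * a i + g = F - ∑ a i
  -- ^ 2`. Hence `a i` must be half of `divX S i (G a)`, with `g = rest S (G a)`.
  let G : (σ → MvPowerSeries σ R) → MvPowerSeries σ R := fun a => F - ∑ j ∈ S, a j ^ 2
  let p : (σ → MvPowerSeries σ R) → Prop := fun a => ∀ i, a i ∈ filt I 2 ∧ a i ∈ filt ⊥ 1
  have hG3 : ∀ a, p a → G a ∈ filt I 3 := fun a ha =>
    sub_mem hF (sum_mem fun j _ => by
      rw [pow_two]
      exact filt_anti (by norm_num) (mul_mem_filt (ha j).1 (ha j).1))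
  have hG2 : ∀ a, p a → G a ∈ filt ⊥ 2 := fun a ha =>
    sub_mem hF2 (sum_mem fun j _ => by
      rw [pow_two]
      exact mul_mem_filt (ha j).2 (ha j).2)
  obtain ⟨a, hpa, hTa⟩ := exists_fixedPoint (I := I)
    (fun a i => C c * divX S i (G a)) p (fun i => ⟨zero_mem _, zero_mem _⟩)
    (fun a ha i => ⟨Ideal.mul_mem_left _ _ (divX_mem_filt (hG3 a ha)),
      Ideal.mul_mem_left _ _ (divX_mem_filt (hG2 a ha))⟩)
    (by
      intro a ha i
      constructor
      · obtain ⟨b, hb, hab⟩ := ha 2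
        simpa using add_mem (hab i) (hb i).1
      · rw [mem_filt_bot]
        intro d hd
        -- Vanishing of the constant term passes to limits because `I` is Hausdorff: the term lies
        -- in every `I ^ n`.
        obtain rfl : d = 0 := (Finsupp.degree_eq_zero_iff d).mp (by omega)
        refine IsHausdorff.haus' (I := I) _ fun n => ?_
        rw [SModEq.zero, smul_eq_mul, Ideal.mul_top]
        obtain ⟨b, hb, hab⟩ := ha n
        have h1 := hab i 0
        rw [map_sub, mem_filt_bot.mp (hb i).2 0 (by simp)] at h1
        simpa using h1)
    (by
      intro k a b ha hb hab i
      rw [← mul_sub, ← divX_sub]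
      refine Ideal.mul_mem_left _ _ (divX_mem_filt ?_)
      rw [show G a - G b = ∑ j ∈ S, (b j ^ 2 - a j ^ 2) by
        simp only [G, Finset.sum_sub_distrib]; ring]
      refine sum_mem fun j _ => ?_
      rw [show b j ^ 2 - a j ^ 2 = -((a j - b j) * (a j + b j)) by ring]
      -- The factor `a j + b j` has weight two and division by a variable costs one, for a net gain
      -- of one.
      exact neg_mem (filt_anti (k := k + 2) le_rfl
        (mul_mem_filt (hab j) (add_mem (ha j).1 (hb j).1))))
  have ha0 : ∀ i ∉ S, a i = 0 := by
    intro i hi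
    rw [← hTa]
    ext d
    have : ∀ d, lead S d ≠ some i := fun d h => hi (lead_eq_some h).1
    simp [coeff_divX, this]
  have hsubst : HasSubst fun i => X i + a i := hasSubst_of_constantCoeff_zero fun i => by
    have := mem_filt_bot.mp (hpa i).2 0 (by simp)
    rw [map_add, constantCoeff_X, zero_add]
    simpa using this
  have hg : ∀ d, coeff d (rest S (G a)) ≠ 0 → ∀ i ∈ S, d i = 0 := by
    intro d hd
    rw [coeff_rest] at hd
    split_ifs at hd with h
    · exact lead_eq_none.mp h
    · exact absurd rfl hd
  refine ⟨rest S (G a), rest_mem_filt (hG3 a hpa), rest_mem_filt (hG2 a hpa), hg, ?_⟩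
  let φ := AlgEquiv.ofBijective _ (bijective_subst_X_add hsubst fun i => (hpa i).1)
  -- `φ` carries the normal form to the given series, so the equivalence asked for is its inverse.
  refine ⟨φ.symm, (AlgEquiv.symm_apply_eq φ).mpr ?_⟩
  have hφX : ∀ i, φ (X i) = X i + a i := fun i => substAlgHom_X hsubst i
  have hφg : φ (rest S (G a)) = rest S (G a) := by
    change substAlgHom (R := R) hsubst _ = _
    rw [substAlgHom_apply, subst_congr hsubst HasSubst.X, subst_self, id]
    intro d hd i hi
    rw [ha0 i fun hiS => Finsupp.mem_support_iff.mp hi (hg d hd i hiS), add_zero]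
  rw [map_add, map_sum, hφg]
  simp only [map_pow, hφX]
  have hcC : (2 : MvPowerSeries σ R) * C c = 1 := by
    rw [← map_ofNat (C : R →+* MvPowerSeries σ R) 2, ← map_mul, hc, map_one]
  have hterm : ∀ i, (X i + a i) ^ 2 = X i ^ 2 + X i * divX S i (G a) + a i ^ 2 := by
    intro i
    have : a i = C c * divX S i (G a) := (congrFun hTa i).symm
    linear_combination 2 * X i * this + X i * divX S i (G a) * hcC
  simp only [hterm, Finset.sum_add_distrib]
  have h3 := sum_X_mul_divX_add_rest S (G a)
  have h4 : G a = F - ∑ j ∈ S, a j ^ 2 := rfl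
  linear_combination -h3 - h4

end Splitting

/-! ### Quadratic parts and linear changes of variables -/

section Leading

variable {σ R : Type*} [CommRing R] [Fintype σ]

lemma sum_X_mul_divX {f : MvPowerSeries σ R} (hf : f ∈ filt ⊥ 1) :
    ∑ i, X i * divX Finset.univ i f = f := by
  have : rest Finset.univ f = 0 := by
    ext d
    rw [coeff_rest]
    split_ifs with h
    · obtain rfl : d = 0 := Finsupp.ext fun i => lead_eq_none.mp h i (Finset.mem_univ i)
      simpa using mem_filt_bot.mp hf 0 (by simp)
    · simp
  simpa [this] using sum_X_mul_divX_add_rest Finset.univ f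

lemma filt_bot_le_span_pow (k : ℕ) : filt (σ := σ) (⊥ : Ideal R) k ≤
    Ideal.span (Set.range (X : σ → MvPowerSeries σ R)) ^ k := by
  induction k with
  | zero => simp
  | succ k ih =>
    intro f hf
    rw [← sum_X_mul_divX (filt_anti (by omega) hf), pow_succ']
    exact sum_mem fun i _ => Ideal.mul_mem_mul
      (Ideal.subset_span (Set.mem_range_self i)) (ih (divX_mem_filt hf))

/-- The quadratic form with matrix `M`, as a power series. -/
def quadSeries (M : Matrix σ σ R) : MvPowerSeries σ R :=
  X ⬝ᵥ (M.map C).mulVec X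

lemma quadSeries_eq_sum (M : Matrix σ σ R) :
    quadSeries M = ∑ i, ∑ j, C (M i j) * (X i * X j) := by
  simp only [quadSeries, dotProduct, Matrix.mulVec, Finset.mul_sum, Matrix.map_apply]
  exact Finset.sum_congr rfl fun i _ => Finset.sum_congr rfl fun j _ => by ring

/-- Dividing twice by leading variables writes `F` in terms of the products `X i * X j`; the
constant terms of the quotients form `M`. One `M` serves every ideal `I`, so both filtrations can be
used on it. -/
lemma exists_sub_quadSeries_mem_filt {F : MvPowerSeries σ R} (hF : F ∈ filt ⊥ 2) :
    ∃ M : Matrix σ σ R, F - quadSeries M ∈ filt ⊥ 3 ∧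
      ∀ (I : Ideal R) (k : ℕ), F ∈ filt I (k + 2) → ∀ i j, M i j ∈ I ^ k := by
  let D : σ → MvPowerSeries σ R → MvPowerSeries σ R := divX Finset.univ
  refine ⟨Matrix.of fun i j => constantCoeff (D j (D i F)), ?_, fun I k hI i j => by
    simpa using divX_mem_filt (S := Finset.univ) (i := j)
      (divX_mem_filt (k := k + 1) (S := Finset.univ) (i := i) hI) 0⟩
  have h1 : F = ∑ i, ∑ j, D j (D i F) * (X i * X j) := by
    conv_lhs => rw [← sum_X_mul_divX (filt_anti one_le_two hF)]
    refine Finset.sum_congr rfl fun i _ => ?_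
    conv_lhs => rw [← sum_X_mul_divX (divX_mem_filt hF)]
    rw [Finset.mul_sum]
    exact Finset.sum_congr rfl fun j _ => by ring
  rw [quadSeries_eq_sum]
  nth_rewrite 1 [h1]
  rw [← Finset.sum_sub_distrib]
  refine sum_mem fun i _ => ?_
  rw [← Finset.sum_sub_distrib]
  refine sum_mem fun j _ => ?_
  rw [← sub_mul]
  refine mul_mem_filt (j := 1) (k := 2) (mem_filt_one_of_constantCoeff ?_)
    (mul_mem_filt (j := 1) (k := 1) (X_mem_filt i) (X_mem_filt j))
  simp

lemma quadSeries_sub (M N : Matrix σ σ R) :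
    quadSeries (M - N) = quadSeries M - quadSeries N := by
  simp only [quadSeries_eq_sum, Matrix.sub_apply, map_sub, sub_mul, Finset.sum_sub_distrib]

/-- `M` need not be symmetric, so polarization only gives `M i j + M j i` in the maximal ideal. As
two is invertible, the series is half of the symmetrized one. -/
lemma quadSeries_mem_filt [IsLocalRing R] (h2 : IsUnit (2 : R)) (M : Matrix σ σ R)
    (hM : ∀ v, v ⬝ᵥ (M.map (IsLocalRing.residue R)).mulVec v = 0) :
    quadSeries M ∈ filt (IsLocalRing.maximalIdeal R) 3 := by
  classical
  have hsym : ∀ i j, M i j + M j i ∈ IsLocalRing.maximalIdeal R := by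
    intro i j
    rw [← IsLocalRing.residue_eq_zero_iff, map_add]
    have h := hM (Pi.single i 1 + Pi.single j 1)
    have hi := hM (Pi.single i 1)
    have hj := hM (Pi.single j 1)
    simp only [Matrix.mulVec_add, dotProduct_add, add_dotProduct, hi, hj] at h
    simpa [add_comm] using h
  obtain ⟨c, hc⟩ := h2.exists_right_inv
  have hcC : (2 : MvPowerSeries σ R) * C c = 1 := by
    rw [← map_ofNat (C : R →+* MvPowerSeries σ R) 2, ← map_mul, hc, map_one]
  have h : quadSeries M = C c * ∑ i, ∑ j, C (M i j + M j i) * (X i * X j) := by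
    have hswap : quadSeries M = ∑ i, ∑ j, C (M j i) * (X i * X j) := by
      rw [quadSeries_eq_sum, Finset.sum_comm]
      exact Finset.sum_congr rfl fun i _ => Finset.sum_congr rfl fun j _ => by ring
    simp only [map_add, add_mul, Finset.sum_add_distrib]
    rw [← hswap, ← quadSeries_eq_sum]
    linear_combination -quadSeries M * hcC
  rw [h]
  refine Ideal.mul_mem_left _ _ (sum_mem fun i _ => sum_mem fun j _ => ?_)
  refine mul_mem_filt (j := 1) (k := 2) (C_mem_filt ?_)
    (mul_mem_filt (j := 1) (k := 1) (X_mem_filt i) (X_mem_filt j))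
  rw [pow_one]
  exact hsym i j

lemma hasSubst_linear (A : Matrix σ σ R) :
    HasSubst fun i => ∑ j, C (A i j) * (X j : MvPowerSeries σ R) :=
  hasSubst_of_constantCoeff_zero fun i => by simp

/-- Substitution of linear forms. -/
def linearSubst (A : Matrix σ σ R) : MvPowerSeries σ R →ₐ[R] MvPowerSeries σ R :=
  substAlgHom (hasSubst_linear A)

lemma linearSubst_X (A : Matrix σ σ R) (i : σ) :
    linearSubst A (X i) = ∑ j, C (A i j) * (X j : MvPowerSeries σ R) :=
  substAlgHom_X _ i

lemma linearSubst_C (A : Matrix σ σ R) (r : R) : linearSubst A (C r) = C r :=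
  (linearSubst A).commutes r

lemma linearSubst_comp [DecidableEq σ] {A B : Matrix σ σ R} (h : B * A = 1) :
    (linearSubst A).comp (linearSubst B) = AlgHom.id R _ := by
  ext1 f
  simp only [AlgHom.comp_apply, AlgHom.id_apply]
  have key : ∀ i, linearSubst A (∑ j, C (B i j) * X j) = X i := by
    intro i
    simp only [map_sum, map_mul, linearSubst_C, linearSubst_X, Finset.mul_sum]
    rw [Finset.sum_comm]
    simp only [← mul_assoc, ← map_mul, ← Finset.sum_mul, ← map_sum, ← Matrix.mul_apply, h,
      Matrix.one_apply]
    simp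
  rw [linearSubst, linearSubst, substAlgHom_apply, substAlgHom_apply,
    subst_comp_subst_apply (hasSubst_linear B) (hasSubst_linear A)]
  have : (fun i => subst (fun i => ∑ j, C (A i j) * (X j : MvPowerSeries σ R))
      (∑ j, C (B i j) * (X j : MvPowerSeries σ R))) = X := by
    funext i
    rw [← substAlgHom_apply (hasSubst_linear A)]
    exact key i
  rw [this, subst_self, id]

/-- The automorphism given by an invertible linear change of the variables. -/
def linearEquiv [DecidableEq σ] (A : Matrix σ σ R) (hA : IsUnit A.det) :
    MvPowerSeries σ R ≃ₐ[R] MvPowerSeries σ R :=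
  AlgEquiv.ofAlgHom (linearSubst A) (linearSubst A⁻¹)
    (linearSubst_comp (Matrix.nonsing_inv_mul A hA)) (linearSubst_comp (Matrix.mul_nonsing_inv A hA))

lemma linearSubst_mem_filt (A : Matrix σ σ R) {I : Ideal R} {k : ℕ} {f : MvPowerSeries σ R}
    (hf : f ∈ filt I k) : linearSubst A f ∈ filt I k := by
  rw [linearSubst, substAlgHom_apply]
  exact subst_mem_filt (hasSubst_linear A)
    (fun i => sum_mem fun j _ => Ideal.mul_mem_left _ _ (X_mem_filt j)) hf

lemma linearSubst_quadSeries (A M : Matrix σ σ R) :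
    linearSubst A (quadSeries M) = quadSeries (A.transpose * M * A) := by
  have h1 : linearSubst A (quadSeries M) =
      ((A.map C).mulVec X) ⬝ᵥ (M.map C).mulVec ((A.map C).mulVec (X : σ → MvPowerSeries σ R)) := by
    simp only [quadSeries, dotProduct, Matrix.mulVec, map_sum, map_mul, Matrix.map_apply,
      linearSubst_C, linearSubst_X]
  rw [h1, quadSeries, Matrix.map_mul, Matrix.map_mul, ← Matrix.mulVec_mulVec,
    ← Matrix.mulVec_mulVec, Matrix.dotProduct_mulVec X, Matrix.transpose_map,
    Matrix.vecMul_transpose]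

end Leading

/-! ### Quadratic forms over a quadratically closed field -/

section Diagonalization

variable {σ K : Type*} [Field K] [Fintype σ] [DecidableEq σ]

lemma exists_perm_of_card_eq {s t : Finset σ} (h : s.card = t.card) :
    ∃ g : Equiv.Perm σ, ∀ x, x ∈ s ↔ g x ∈ t := by
  let e : {x // x ∈ s} ≃ {x // x ∈ t} := Fintype.equivOfCardEq (by simpa using h)
  exact ⟨e.extendSubtype, fun x => ⟨fun hx => e.extendSubtype_mem x hx,
    fun hx => by_contra fun hx' => e.extendSubtype_not_mem x hx' hx⟩⟩

/-- Over a quadratically closed field of characteristic not two, a quadratic form is a sum of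
squares of some of the variables, in suitable coordinates. -/
theorem exists_diagonalization (h2 : (2 : K) ≠ 0) (hK : QuadraticallyClosed K)
    (M : Matrix σ σ K) :
    ∃ r ≤ Fintype.card σ, ∀ S : Finset σ, S.card = r → ∃ P : Matrix σ σ K, IsUnit P.det ∧
      ∀ v, P.mulVec v ⬝ᵥ M.mulVec (P.mulVec v) = ∑ i ∈ S, v i ^ 2 := by
  classical
  have : Invertible (2 : K) := invertibleOfNonzero h2
  let Q : QuadraticForm K (σ → K) := (Matrix.toBilin' M).toQuadraticMap
  have hQ : ∀ v, Q v = v ⬝ᵥ M.mulVec v := fun v => by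
    simp [Q, Matrix.toBilin'_apply']
  obtain ⟨w, ⟨L⟩⟩ := QuadraticForm.equivalent_weightedSumSquares Q
  let W := Finset.univ.filter fun i => w i ≠ 0
  have hcard : Fintype.card (Fin (Module.finrank K (σ → K))) = Fintype.card σ := by simp
  refine ⟨W.card, hcard ▸ W.card_le_univ, fun S hS => ?_⟩
  let e' : Fin (Module.finrank K (σ → K)) ≃ σ := Fintype.equivOfCardEq hcard
  obtain ⟨g, hg⟩ := exists_perm_of_card_eq (s := W.map e'.toEmbedding) (t := S) (by simp [hS])
  let e := e'.trans g
  have he : ∀ i, w i ≠ 0 ↔ e i ∈ S := fun i => by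
    rw [show e i = g (e' i) from rfl, ← hg]
    simp [W]
  choose s hs using fun i => hK (w i)
  -- Where the weight vanishes the scaling factor is set to one, to keep the rescaling invertible.
  have hu : ∀ i, (if w i = 0 then 1 else s i) ≠ 0 := by
    intro i
    split_ifs with h
    · exact one_ne_zero
    · intro h0
      exact h (by rw [hs, h0, zero_mul])
  let u : ∀ i, Kˣ := fun i => Units.mk0 _ (hu i)
  let E : (σ → K) ≃ₗ[K] (σ → K) :=
    ((LinearEquiv.funCongrLeft K K e).trans (LinearEquiv.piCongrRight fun i =>
      LinearEquiv.smulOfUnit (u i)⁻¹)).trans L.toLinearEquiv.symm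
  refine ⟨LinearMap.toMatrix' E.toLinearMap, ?_, fun v => ?_⟩
  · rw [LinearMap.det_toMatrix']
    exact LinearEquiv.isUnit_det' E
  · rw [← hQ, LinearMap.toMatrix'_mulVec]
    have h1 : ∀ i, L (E v) i = (u i : K)⁻¹ * v (e i) := by
      intro i
      have : L (E v) = LinearEquiv.piCongrRight (fun i => LinearEquiv.smulOfUnit (M := K) (u i)⁻¹)
        (LinearEquiv.funCongrLeft K K e v) := L.toLinearEquiv.apply_symm_apply _
      rw [this]
      simp [LinearEquiv.smulOfUnit, LinearEquiv.funCongrLeft_apply, Units.smul_def]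
    change Q (E v) = _
    rw [← L.map_app, QuadraticMap.weightedSumSquares_apply]
    have h3 : ∀ i, w i • (L (E v) i * L (E v) i) = if e i ∈ S then v (e i) ^ 2 else 0 := by
      intro i
      rw [h1, smul_eq_mul]
      by_cases h : w i = 0
      · rw [if_neg fun h' => (he i).mpr h' h, h, zero_mul]
      · rw [if_pos ((he i).mp h)]
        have hs0 : s i ≠ 0 := by simpa [h] using hu i
        simp only [u, Units.val_mk0, if_neg h]
        rw [hs i]
        field_simp
    simp only [h3]
    rw [Equiv.sum_comp e fun j => if j ∈ S then v j ^ 2 else 0]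
    simp

end Diagonalization

/-! ### The splitting lemma over a complete local ring -/

section LocalRing

variable {σ R : Type*} [CommRing R]

lemma RightEquiv.trans {f g h : MvPowerSeries σ R} (h1 : RightEquiv f g) (h2 : RightEquiv g h) :
    RightEquiv f h := by
  obtain ⟨φ, rfl⟩ := h1
  obtain ⟨ψ, rfl⟩ := h2
  exact ⟨φ.trans ψ, rfl⟩

variable [IsLocalRing R]

lemma maximalIdeal_le_filt : IsLocalRing.maximalIdeal (MvPowerSeries σ R) ≤
    filt (IsLocalRing.maximalIdeal R) 1 := by
  intro f hf
  refine mem_filt_one_of_constantCoeff ?_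
  rw [IsLocalRing.mem_maximalIdeal, mem_nonunits_iff, ← isUnit_iff_constantCoeff]
  exact hf

/-- With `maximalIdeal_le_filt` and `pow_filt_le`, this identifies the weight filtration with the
powers of the maximal ideal. -/
lemma filt_maximalIdeal_le [Fintype σ] (k : ℕ) : filt (IsLocalRing.maximalIdeal R) k ≤
    IsLocalRing.maximalIdeal (MvPowerSeries σ R) ^ k := by
  have hX : ∀ i, (X i : MvPowerSeries σ R) ∈ IsLocalRing.maximalIdeal (MvPowerSeries σ R) := by
    intro i
    rw [IsLocalRing.mem_maximalIdeal, mem_nonunits_iff, isUnit_iff_constantCoeff]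
    simp
  have hC : (IsLocalRing.maximalIdeal R).map (C : R →+* MvPowerSeries σ R) ≤
      IsLocalRing.maximalIdeal (MvPowerSeries σ R) := by
    rw [Ideal.map_le_iff_le_comap]
    intro r hr
    rw [Ideal.mem_comap, IsLocalRing.mem_maximalIdeal, mem_nonunits_iff, isUnit_iff_constantCoeff]
    simpa using hr
  induction k with
  | zero => simp
  | succ k ih =>
    intro f hf
    have hrest : rest Finset.univ f = C (constantCoeff f) := by
      classical
      ext d
      rw [coeff_rest, coeff_C]
      by_cases hd : d = 0
      · subst hd
        simp [lead_eq_none]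
      · have : lead Finset.univ d ≠ none := fun h =>
          hd (Finsupp.ext fun i => lead_eq_none.mp h i (Finset.mem_univ i))
        simp [this, hd]
    rw [← sum_X_mul_divX_add_rest Finset.univ f, hrest]
    refine add_mem (sum_mem fun i _ => ?_) ?_
    · rw [pow_succ']
      exact Ideal.mul_mem_mul (hX i) (ih (divX_mem_filt hf))
    · refine Ideal.pow_right_mono hC (k + 1) ?_
      rw [← Ideal.map_pow]
      exact Ideal.mem_map_of_mem _ (by simpa using hf 0)

/-- The splitting lemma over a complete local ring with quadratically closed residue field. -/
theorem exists_rightEquiv_sum_sq_add [Fintype σ]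
    [IsAdicComplete (IsLocalRing.maximalIdeal R) R] (h2 : IsUnit (2 : R))
    (hquad : QuadraticallyClosed (IsLocalRing.ResidueField R)) {F : MvPowerSeries σ R}
    (hF2 : F ∈ filt ⊥ 2) (hF3 : F ∉ filt (IsLocalRing.maximalIdeal R) 3) :
    ∃ r, r ≠ 0 ∧ r ≤ Fintype.card σ ∧ ∀ S : Finset σ, S.card = r → ∃ g : MvPowerSeries σ R,
      g ∈ filt (IsLocalRing.maximalIdeal R) 3 ∧ g ∈ filt ⊥ 2 ∧
      (∀ d, coeff d g ≠ 0 → ∀ i ∈ S, d i = 0) ∧ RightEquiv F (∑ i ∈ S, X i ^ 2 + g) := by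
  classical
  let res := IsLocalRing.residue R
  obtain ⟨M, hM, -⟩ := exists_sub_quadSeries_mem_filt hF2
  obtain ⟨r, hr, hdiag⟩ := exists_diagonalization
    (by simpa only [map_ofNat] using (h2.map res).ne_zero) hquad (M.map res)
  refine ⟨r, ?_, hr, fun S hS => ?_⟩
  -- Rank zero means that the quadratic part vanishes over the residue field, which would give `F`
  -- weight three.
  · rintro rfl
    obtain ⟨P, hP, hPM⟩ := hdiag ∅ rfl
    refine hF3 ?_
    rw [← sub_add_cancel F (quadSeries M)]
    refine add_mem (filt_mono bot_le hM) (quadSeries_mem_filt h2 M fun v => ?_)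
    have := hPM (P⁻¹.mulVec v)
    rwa [Matrix.mulVec_mulVec, Matrix.mul_nonsing_inv P hP, Matrix.one_mulVec,
      Finset.sum_empty] at this
  · obtain ⟨P, hP, hPM⟩ := hdiag S hS
    -- Any entrywise lift of `P` works: its determinant is a unit because its residue is.
    choose A' hA' using fun i j => IsLocalRing.residue_surjective (R := R) (P i j)
    let A : Matrix σ σ R := Matrix.of A'
    have hAP : A.map res = P := Matrix.ext hA'
    have hA : IsUnit A.det := by
      refine isUnit_of_map_unit res _ ?_
      rwa [RingHom.map_det, RingHom.mapMatrix_apply, hAP]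
    let D : Matrix σ σ R := Matrix.diagonal fun i => if i ∈ S then 1 else 0
    have hD : quadSeries D = ∑ i ∈ S, X i ^ 2 := by
      rw [quadSeries_eq_sum]
      simp only [D, Matrix.diagonal_apply]
      simp [apply_ite, ite_mul, pow_two]
    have hsplit : linearSubst A F - ∑ i ∈ S, X i ^ 2 ∈ filt (IsLocalRing.maximalIdeal R) 3 := by
      have : linearSubst A F - ∑ i ∈ S, X i ^ 2 =
          linearSubst A (F - quadSeries M) + quadSeries (A.transpose * M * A - D) := by
        rw [map_sub, linearSubst_quadSeries, quadSeries_sub, hD]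
        ring
      rw [this]
      refine add_mem (filt_mono bot_le (linearSubst_mem_filt A hM))
        (quadSeries_mem_filt h2 _ fun v => ?_)
      have hmap : (A.transpose * M * A - D).map res = P.transpose * M.map res * P -
          Matrix.diagonal fun i => if i ∈ S then 1 else 0 := by
        rw [Matrix.map_sub _ (map_sub res), Matrix.map_mul, Matrix.map_mul, Matrix.transpose_map,
          hAP, Matrix.diagonal_map (map_zero res)]
        congr 2
        funext i
        simp [apply_ite]
      rw [show (A.transpose * M * A - D).map (IsLocalRing.residue R) = _ from hmap,
        Matrix.sub_mulVec, dotProduct_sub, sub_eq_zero, ← Matrix.mulVec_mulVec,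
        ← Matrix.mulVec_mulVec, Matrix.dotProduct_mulVec v, Matrix.vecMul_transpose, hPM v]
      simp [dotProduct, Matrix.mulVec_diagonal, pow_two]
    have hsplit2 : linearSubst A F - ∑ i ∈ S, X i ^ 2 ∈ filt ⊥ 2 :=
      sub_mem (linearSubst_mem_filt A hF2) (sum_mem fun i _ => by
        rw [pow_two]
        exact mul_mem_filt (X_mem_filt i) (X_mem_filt i))
    obtain ⟨g, hg3, hg2, hgS, hg⟩ := exists_splitting h2 S hsplit hsplit2
    refine ⟨g, hg3, hg2, hgS, RightEquiv.trans ⟨linearEquiv A hA, ?_⟩ hg⟩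
    rw [add_sub_cancel]
    rfl

end LocalRing

/-! ### From weights in `f` to degrees in its transform, and back -/

section DiscreteValuationRing

variable {V : Type*} [CommRing V] [IsDomain V] [IsDiscreteValuationRing V] {ϖ : V}

/-- Weight three makes the quadratic coefficients divisible by `ϖ`, and the rest has degree at least
three. There are no linear terms, so the summands `i = 0` and `i = 1` suffice. -/
lemma mem_idealA_three {σ : Type*} [Fintype σ] (hϖ : Irreducible ϖ) {g : MvPowerSeries σ V}
    (hg3 : g ∈ filt (IsLocalRing.maximalIdeal V) 3) (hg2 : g ∈ filt ⊥ 2) :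
    g ∈ idealA ϖ σ 3 := by
  have hle : ∀ i < 3, Ideal.span {(C (ϖ ^ i) : MvPowerSeries σ V)} *
      Ideal.span (Set.range (X : σ → MvPowerSeries σ V)) ^ (3 - i) ≤ idealA ϖ σ 3 := by
    intro i hi
    rw [idealA, Ideal.sum_eq_sup]
    exact Finset.le_sup (f := fun i => Ideal.span {(C (ϖ ^ i) : MvPowerSeries σ V)} *
      Ideal.span (Set.range (X : σ → MvPowerSeries σ V)) ^ (3 - i)) (Finset.mem_range.mpr hi)
  obtain ⟨M, hM, hMI⟩ := exists_sub_quadSeries_mem_filt hg2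
  rw [← sub_add_cancel g (quadSeries M), quadSeries_eq_sum]
  refine add_mem (hle 0 (by norm_num) ?_)
    (sum_mem fun i _ => sum_mem fun j _ => hle 1 (by norm_num) ?_)
  · rw [pow_zero, map_one, Ideal.span_singleton_one, Ideal.top_mul, ← quadSeries_eq_sum]
    exact filt_bot_le_span_pow 3 hM
  · refine Ideal.mul_mem_mul ?_ ?_
    · have := hMI _ 1 hg3 i j
      rw [pow_one, hϖ.maximalIdeal_eq, Ideal.mem_span_singleton] at this
      rw [pow_one, Ideal.mem_span_singleton]
      exact map_dvd C this
    · rw [show 3 - 1 = 2 from rfl, pow_two]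
      exact Ideal.mul_mem_mul (Ideal.subset_span (Set.mem_range_self i))
        (Ideal.subset_span (Set.mem_range_self j))

lemma mem_maximalIdeal_pow_iff (hϖ : Irreducible ϖ) {a : V} (ha : a ≠ 0) {k : ℕ} :
    a ∈ IsLocalRing.maximalIdeal V ^ k ↔ k ≤ multiplicity ϖ a := by
  have hfin : FiniteMultiplicity ϖ a := FiniteMultiplicity.of_prime_left hϖ.prime ha
  rw [hϖ.maximalIdeal_eq, Ideal.span_singleton_pow, Ideal.mem_span_singleton,
    hfin.pow_dvd_iff_le_multiplicity]

lemma isUnit_unitPart (hϖ : Irreducible ϖ) {a : V} (ha : a ≠ 0) : IsUnit (unitPart ϖ a) := by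
  rw [unitPart, if_neg ha]
  have h := (pow_multiplicity_dvd ϖ a).choose_spec
  by_contra hu
  have hdvd : ϖ ∣ (pow_multiplicity_dvd ϖ a).choose := by
    rw [← Ideal.mem_span_singleton, ← hϖ.maximalIdeal_eq]
    exact hu
  have hfin : FiniteMultiplicity ϖ a := FiniteMultiplicity.of_prime_left hϖ.prime ha
  refine hfin.not_pow_dvd_of_multiplicity_lt (Nat.lt_succ_self _) ?_
  rw [pow_succ]
  conv_rhs => rw [h]
  exact mul_dvd_mul_left _ hdvd

variable {n : ℕ} {f : MvPowerSeries (Fin n) V}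

omit [IsDomain V] [IsDiscreteValuationRing V] in
lemma coeff_tilde (β : Option (Fin n) →₀ ℕ) : coeff β (tilde ϖ f) =
    if β none = multiplicity ϖ (coeff β.some f) then unitPart ϖ (coeff β.some f) else 0 := rfl

lemma degree_option (β : Option (Fin n) →₀ ℕ) : β.degree = β none + β.some.degree := by
  simp [Finsupp.degree_eq_sum, Fintype.sum_option]

lemma tilde_mem_filt (hϖ : Irreducible ϖ) {k : ℕ}
    (hf : f ∈ filt (IsLocalRing.maximalIdeal V) k) : tilde ϖ f ∈ filt ⊥ k := by
  rw [mem_filt_bot]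
  intro β hβ
  rw [coeff_tilde]
  split_ifs with h
  -- The multiplicity of `ϖ` in `0` is a default value; it is harmless because the unit part is then
  -- `0`.
  · by_cases h0 : coeff β.some f = 0
    · simp [unitPart, h0]
    · have := (mem_maximalIdeal_pow_iff hϖ h0).mp (hf β.some)
      rw [degree_option] at hβ
      omega
  · rfl

lemma mem_filt_of_tilde_mem_filt (hϖ : Irreducible ϖ) {k : ℕ}
    (hf : tilde ϖ f ∈ filt (IsLocalRing.maximalIdeal V) k) :
    f ∈ filt (IsLocalRing.maximalIdeal V) k := by
  intro α
  by_cases h0 : coeff α f = 0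
  · simp [h0]
  rw [mem_maximalIdeal_pow_iff hϖ h0]
  by_contra hlt
  -- This is the exponent that the monomial `α` acquires; the coefficient there is a unit, so it
  -- lies in no positive power of the maximal ideal.
  let β := α.optionElim (multiplicity ϖ (coeff α f))
  have hβ0 : β none = multiplicity ϖ (coeff α f) := by simp [β]
  have hβα : β.some = α := by simp [β]
  have h := hf β
  rw [coeff_tilde, hβα, if_pos hβ0, degree_option, hβα, hβ0] at h
  exact (IsLocalRing.mem_maximalIdeal _).mp
    (Ideal.pow_le_self (by omega) h) (isUnit_unitPart hϖ h0)

omit [IsDomain V] [IsDiscreteValuationRing V] in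
/-- A power series in `x_1, …, x_n, y` without `x_1, …, x_k, y` comes from a power series in the
other variables. -/
lemma exists_tailIncl_eq {k : ℕ} {g : MvPowerSeries (Option (Fin n)) V}
    (hg : ∀ d, coeff d g ≠ 0 → d none = 0 ∧ ∀ i : Fin n, (i : ℕ) < k → d (some i) = 0) :
    ∃ g' : MvPowerSeries (TailIndex n k) V, tailIncl V n k g' = g ∧
      ∀ (I : Ideal V) (j : ℕ), g ∈ filt I j → g' ∈ filt I j := by
  let e : TailIndex n k ↪ Option (Fin n) :=
    ⟨fun i => some i.1, fun i j h => Subtype.ext (Option.some.inj h)⟩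
  let g' : MvPowerSeries (TailIndex n k) V := fun d => coeff (d.embDomain e) g
  have hg' : ∀ d, coeff d g' = coeff (d.embDomain e) g := fun d => rfl
  refine ⟨g', ?_, fun I j h d => ?_⟩
  · ext d
    change coeff d (rename e g') = _
    by_cases hd : d ∈ Set.range (Finsupp.mapDomain e)
    · obtain ⟨c, rfl⟩ := hd
      rw [← Finsupp.embDomain_eq_mapDomain, coeff_embDomain_rename, hg']
    · rw [coeff_rename_eq_zero _ _ hd]
      by_contra h0
      obtain ⟨h1, h2⟩ := hg d (Ne.symm h0)
      refine hd ?_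
      rw [Finsupp.mem_range_mapDomain_iff _ e.injective]
      rintro (_ | i) hi
      · exact h1
      · refine h2 i (not_le.mp fun hk => hi ⟨⟨i, hk⟩, rfl⟩)
  · have := h (d.embDomain e)
    rwa [Finsupp.embDomain_eq_mapDomain, Finsupp.degree_mapDomain,
      ← Finsupp.embDomain_eq_mapDomain] at this

end DiscreteValuationRing

end DVRSeries

end

theorem mainTheorem5 {V : Type*} [CommRing V] [IsDomain V] [IsDiscreteValuationRing V]
    [IsAdicComplete (IsLocalRing.maximalIdeal V) V]
    (ϖ : V) (hϖ : Irreducible ϖ)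
    (hquad : DVRSeries.QuadraticallyClosed (IsLocalRing.ResidueField V))
    (hchar : ringChar (IsLocalRing.ResidueField V) ≠ 2)
    (n : ℕ) (f : MvPowerSeries (Fin n) V)
    (hf : DVRSeries.HasOrder (IsLocalRing.maximalIdeal (MvPowerSeries (Fin n) V)) f 2) :
    ∃ k : ℕ, k ≤ n ∧
      ∃ g : MvPowerSeries (DVRSeries.TailIndex n k) V,
        g ∈ DVRSeries.idealA ϖ (DVRSeries.TailIndex n k) 3 ∧
        DVRSeries.RightEquiv (DVRSeries.tilde ϖ f)
          ((MvPowerSeries.X none : MvPowerSeries (Option (Fin n)) V) ^ 2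
            + ∑ i ∈ Finset.univ.filter (fun i : Fin n => (i : ℕ) < k),
                (MvPowerSeries.X (some i) : MvPowerSeries (Option (Fin n)) V) ^ 2
            + DVRSeries.tailIncl V n k g) := by
  open DVRSeries in
  have h2 : IsUnit (2 : V) := by
    refine isUnit_of_map_unit (IsLocalRing.residue V) _ ?_
    rw [map_ofNat, isUnit_iff_ne_zero]
    exact Ring.two_ne_zero hchar
  have hf2 : tilde ϖ f ∈ filt ⊥ 2 := tilde_mem_filt hϖ
    (pow_filt_le (Ideal.pow_right_mono maximalIdeal_le_filt 2 hf.1))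
  have hf3 : tilde ϖ f ∉ filt (IsLocalRing.maximalIdeal V) 3 := fun h =>
    by
    have := hf.2 (show 3 ∈ {j : ℕ | _} from
      filt_maximalIdeal_le 3 (mem_filt_of_tilde_mem_filt hϖ h))
    omega
  obtain ⟨r, hr0, hr, H⟩ := exists_rightEquiv_sum_sq_add h2 hquad hf2 hf3
  rw [Fintype.card_option, Fintype.card_fin] at hr
  let T : Finset (Fin n) := Finset.univ.filter fun i => (i : ℕ) < r - 1
  have hT : T.card = r - 1 := by
    rw [Fin.card_filter_val_lt]
    omega
  -- The squares are placed on `y` and the first `r - 1` variables; `r ≠ 0` leaves room for `y`.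
  obtain ⟨g, hg3, hg2, hgS, hg⟩ := H T.insertNone (by rw [Finset.card_insertNone, hT]; omega)
  obtain ⟨g', hg', hfilt⟩ := exists_tailIncl_eq (k := r - 1) (g := g) fun d hd =>
    ⟨hgS d hd none (by simp), fun i hi => hgS d hd (some i) (by simp [T, hi])⟩
  refine ⟨r - 1, by omega, g', mem_idealA_three hϖ (hfilt _ _ hg3) (hfilt _ _ hg2), ?_⟩
  rw [hg']
  rwa [Finset.sum_insertNone] at hg
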